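/- Let $\mathcal F$ be a filter on $\omega$, i.e. a family of infinite subsets of $\omega$ that contains all cofinite sets and is closed under finite intersections and supersets. Let $[\omega]^{<\omega}$ denote the countable set of all nonempty finite subsets of $\omega$, and let $\mathcal F^{<\omega}$ be the filter on $[\omega]^{<\omega}$ consisting of all $\mathcal A\subseteq[\omega]^{<\omega}$ that contain $\{a\in[\omega]^{<\omega}: a\subseteq F\}$ for some $F\in\mathcal F$. Then the following are equivalent: 1. the Mathias forcing $\mathbb M_{\mathcal F}$ does not add dominating reals; 2. $\mathcal F$ is Menger; 3. $\mathcal F^{<\omega}$ is Menger; 4. $\mathcal F^{<\omega}$ is a $P^+$-filter; 5. $\mathcal F$ is a strong $P^+$-filter; 6. $\mathcal F^{<\omega}$ is a strong $P^+$-filter (where $[\omega]^{<\omega}$ is identified with $\omega$ by an arbitrary fixed bijection). Here $\mathbb M_{\mathcal F}$ consists of the pairs $\langle s,F\rangle$ with $s$ a finite (possibly empty) subset of $\omega$, $F\in\mathcal F$ and $\max s<\min F$ (no requirement if $s=\emptyset$), where $\langle s,F\rangle\le\langle t,G\rangle$ ($\langle s,F\rangle$ is stronger) iff $F\subseteq G$,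 $s$ is an end-extension of $t$ and $s\setminus t\subseteq G$. A forcing adds no dominating reals if no condition $p$ and no name $\dot x$ for an element of $\omega^\omega$ satisfy $p\Vdash$ "for every $a\in\omega^\omega$ of the ground model, $a(n)\le\dot x(n)$ for all but finitely many $n$". A topological space $X$ is Menger if for every sequence $(\mathcal U_n)_{n\in\omega}$ of open covers of $X$ there are finite $\mathcal V_n\subseteq\mathcal U_n$ such that $\bigcup_n\mathcal V_n$ covers $X$; a filter on a countable set $S$ is regarded as a subspace of $\mathcal P(S)=2^S$ with the product topology. For a filter $\mathcal G$ on a countable set $S$, $\mathcal G^+$ is the family of all $A\subseteq S$ with $S\setminus A\notin\mathcal G$. $\mathcal G$ is a $P^+$-filter if for every decreasing sequence $(X_n)_{n\in\omega}$ in $\mathcal G^+$ there is $X\in\mathcal G^+$ with $X\setminus X_n$ finite for all $n$. A filter $\mathcal G$ on $\omega$ is a strong $P^+$-filter if for every sequence $(\mathcal C_n)_{n\in\omega}$ of compact subsets of $\mathcal P(\omega)$ with $\mathcal C_n\subseteq\mathcal G^+$ there is a strictly increasing sequence $(k_n)_{n\in\omega}$ of natural numbers such that $\bigcup_n\bigl(X_n\cap[k_n,k_{n+1})\bigr)\in\mathcal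 G^+$ whenever $X_n\in\mathcal C_n$ for all $n$. -/

import Mathlib

namespace FilterForcing

/-! ### Names for reals and the forcing relation -/

section Forcing

variable {P : Type*} [Preorder P]

/-- Two conditions are compatible if they have a common extension (`r ≤ p` means that `r` is
stronger than `p`). -/
def Compatible (p q : P) : Prop := ∃ r : P, r ≤ p ∧ r ≤ q

/-- A (nice) `P`-name for an element of `ω^ω`: the name whose elements are the pairs
`((n, k)ˇ, p)` with `p ∈ val n k`, where the trivial condition forces this set of pairs to be a
function (`functional`) that is defined on all of `ω` (`total`). -/
structure RealName (P : Type*) [Preorder P] where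
  val : ℕ → ℕ → Set P
  functional : ∀ (n k l : ℕ) (p q : P), p ∈ val n k → q ∈ val n l → Compatible p q → k = l
  total : ∀ (n : ℕ) (p : P), ∃ k : ℕ, ∃ q ∈ val n k, Compatible p q

/-- The clause of the forcing relation for existential quantifiers: `p` forces that some `i` in
the ground model set `s` satisfies `φ i` iff the conditions forcing an instance are dense below
`p`. -/
def ForcesExists {ι : Type*} (s : Set ι) (φ : ι → P → Prop) (p : P) : Prop :=
  ∀ q ≤ p, ∃ r ≤ q, ∃ i ∈ s, φ i r

/-- `p ⊩ x(n) = k`, that is, `p` forces the pair `(n, k)` to belong to the name `x`. -/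
def RealName.ForcesEq (x : RealName P) (n k : ℕ) (p : P) : Prop :=
  ForcesExists (x.val n k) (fun c r => r ≤ c) p

/-- `p ⊩ a ≤* x`, that is, `p ⊩ ∃ m, ∀ n ≥ m, ∃ k ≥ a(n), x(n) = k`, for a ground model
function `a`. -/
def RealName.ForcesDominates (x : RealName P) (a : ℕ → ℕ) (p : P) : Prop :=
  ForcesExists Set.univ
    (fun m q => ∀ n ≥ m, ForcesExists {k | a n ≤ k} (fun k r => x.ForcesEq n k r) q) p

/-- `p` forces `x` to be a dominating real: `p ⊩ a ≤* x` for every `a ∈ ω^ω` of the ground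
model. -/
def RealName.ForcesDominating (x : RealName P) (p : P) : Prop :=
  ∀ a : ℕ → ℕ, x.ForcesDominates a p

/-- `P` does not add dominating reals: no condition forces a name to be a dominating real. -/
def AddsNoDominatingReal (P : Type*) [Preorder P] : Prop :=
  ∀ (x : RealName P) (p : P), ¬ x.ForcesDominating p

end Forcing

/-! ### Mathias forcing associated with a filter -/

/-- Conditions `⟨s, A⟩` of the Mathias forcing associated with `F`: `s` is a finite subset of
`ω`, `A ∈ F`, and `max s < min A`. -/
structure Mathias (F : Filter ℕ) where
  stem : Finset ℕ
  side : Set ℕ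
  side_mem : side ∈ F
  stem_lt_side : ∀ i ∈ stem, ∀ j ∈ side, i < j

/-- `⟨s, A⟩ ≤ ⟨t, B⟩` iff `A ⊆ B`, `s` is an end-extension of `t`, and `s \ t ⊆ B`. -/
instance Mathias.instPreorder (F : Filter ℕ) : Preorder (Mathias F) where
  le p q := p.side ⊆ q.side ∧
    (q.stem ⊆ p.stem ∧ ∀ i ∈ q.stem, ∀ j ∈ p.stem \ q.stem, i < j) ∧
    ((p.stem \ q.stem : Finset ℕ) : Set ℕ) ⊆ q.side
  le_refl p := by simp
  le_trans p q r := by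
    rintro ⟨h1, ⟨h2, h3⟩, h4⟩ ⟨k1, ⟨k2, k3⟩, k4⟩
    refine ⟨h1.trans k1, ⟨k2.trans h2, ?_⟩, ?_⟩
    · intro i hi j hj
      rw [Finset.mem_sdiff] at hj
      by_cases hq : j ∈ q.stem
      · exact k3 i hi j (Finset.mem_sdiff.2 ⟨hq, hj.2⟩)
      · exact h3 i (k2 hi) j (Finset.mem_sdiff.2 ⟨hj.1, hq⟩)
    · intro j hj
      rw [Finset.mem_coe, Finset.mem_sdiff] at hj
      by_cases hq : j ∈ q.stem
      · exact k4 (Finset.mem_coe.2 (Finset.mem_sdiff.2 ⟨hq, hj.2⟩))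
      · exact k1 (h4 (Finset.mem_coe.2 (Finset.mem_sdiff.2 ⟨hj.1, hq⟩)))

/-! ### The Menger property -/

/-- The Menger covering property of a topological space. -/
def MengerSpace (X : Type*) [TopologicalSpace X] : Prop :=
  ∀ U : ℕ → Set (Set X),
    (∀ n, (∀ u ∈ U n, IsOpen u) ∧ ⋃₀ (U n) = Set.univ) →
      ∃ V : ℕ → Set (Set X),
        (∀ n, V n ⊆ U n ∧ (V n).Finite) ∧ (⋃ n, ⋃₀ (V n)) = Set.univ

/-- The subset of `S` with characteristic function `x`. -/
def toSet {S : Type*} (x : S → Bool) : Set S := {s | x s = true}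

/-- A family of subsets of `S` as a subspace of the Cantor space `2^S` (with the product
topology), via characteristic functions. -/
def cantorSubspace {S : Type*} (𝒳 : Set (Set S)) : Set (S → Bool) := {x | toSet x ∈ 𝒳}

/-- A filter is Menger if it is a Menger subspace of the power set. -/
def IsMenger {S : Type*} (F : Filter S) : Prop := MengerSpace (cantorSubspace F.sets)

/-! ### `P⁺`-filters and strong `P⁺`-filters -/

/-- The family `F⁺` of `F`-positive sets: those not in the dual ideal. -/
def positive {S : Type*} (F : Filter S) : Set (Set S) := {A | Aᶜ ∉ F}

/-- `F` is a `P⁺`-filter: every decreasing sequence of positive sets has a positive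
pseudo-intersection. -/
def IsPPlus {S : Type*} (F : Filter S) : Prop :=
  ∀ X : ℕ → Set S, Antitone X → (∀ n, X n ∈ positive F) →
    ∃ Y ∈ positive F, ∀ n, (Y \ X n).Finite

/-- `F` is a strong `P⁺`-filter: for every sequence of compact sets `C n ⊆ F⁺` there is an
increasing sequence `k` of integers such that `⋃ n, X n ∩ [k n, k (n + 1))` is positive whenever
`X n ∈ C n` for all `n`. -/
def IsStrongPPlus (F : Filter ℕ) : Prop :=
  ∀ C : ℕ → Set (ℕ → Bool), (∀ n, IsCompact (C n) ∧ C n ⊆ cantorSubspace (positive F)) →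
    ∃ k : ℕ → ℕ, StrictMono k ∧
      ∀ X : ℕ → ℕ → Bool, (∀ n, X n ∈ C n) →
        (⋃ n, toSet (X n) ∩ Set.Ico (k n) (k (n + 1))) ∈ positive F

/-! ### The filter `F^{<ω}` -/

/-- The countable set of nonempty finite subsets of `ω`. -/
abbrev NeFin : Type := {a : Finset ℕ // a.Nonempty}

/-- The filter `F^{<ω}` generated by the sets of all (nonempty) finite subsets of `A`,
for `A ∈ F`. -/
def finPow (F : Filter ℕ) : Filter NeFin where
  sets := {𝒜 | ∃ A ∈ F, {a : NeFin | (a.1 : Set ℕ) ⊆ A} ⊆ 𝒜}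
  univ_sets := ⟨Set.univ, Filter.univ_mem, Set.subset_univ _⟩
  sets_of_superset := by
    rintro x y ⟨A, hA, h⟩ hxy
    exact ⟨A, hA, h.trans hxy⟩
  inter_sets := by
    rintro x y ⟨A, hA, h⟩ ⟨B, hB, k⟩
    exact ⟨A ∩ B, Filter.inter_mem hA hB, fun a ha =>
      ⟨h (ha.trans Set.inter_subset_left), k (ha.trans Set.inter_subset_right)⟩⟩

end FilterForcing

namespace FilterForcing

/-! ### A combinatorial form of the Menger property -/

/-! Every condition reduces to `FinMenger F`, the Menger property for covers by the sets `{X | a ⊆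
X}` with `a` finite. Since `F` is closed under supersets, the supersets of each `X ∈ F` form a
compact subset of `F`; hence finitely many members of any open cover already cover all supersets of
some finite `a ⊆ X`.

In this form, passing to `finPow F` changes nothing, as a finite family of finite sets lies below
`A` iff its union does. The positive sets of `finPow F` are exactly the families that hit `F`, which
gives the `P⁺` condition. Compact subsets of `F⁺` are handled through the finite sets that meet all
their members, which gives the strong `P⁺` condition.

For the forcing, the function recording how far the generic real must be searched to capture a
member of `𝒜 n` is dominating if `𝒜` refutes `FinMenger`. Conversely, `FinMenger` selects, for each
`n`, finitely many finite sets through which a given name can be decided, so the decided values are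
bounded by a ground model function. -/

/-- Every member of `F` contains a member of the family `𝒜` of finite sets. -/
def Hits {S : Type*} (F : Filter S) (𝒜 : Set (Finset S)) : Prop :=
  ∀ X ∈ F, ∃ a ∈ 𝒜, (a : Set S) ⊆ X

/-- The Menger property restricted to covers by the sets `{X | a ⊆ X}`, with `a` finite. -/
def FinMenger {S : Type*} (F : Filter S) : Prop :=
  ∀ 𝒜 : ℕ → Set (Finset S), (∀ n, Hits F (𝒜 n)) →
    ∃ ℬ : ℕ → Set (Finset S), (∀ n, ℬ n ⊆ 𝒜 n ∧ (ℬ n).Finite) ∧ Hits F (⋃ n, ℬ n)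

theorem isClosed_forall_eq_true {S : Type*} (X : Set S) :
    IsClosed {y : S → Bool | ∀ i ∈ X, y i = true} := by
  simp only [Set.ofPred_forall]
  exact isClosed_iInter fun i => isClosed_iInter fun _ =>
    isClosed_eq (continuous_apply i) continuous_const

theorem isOpen_eval_eq {S : Type*} (i : S) (b : Bool) : IsOpen {y : S → Bool | y i = b} :=
  (continuous_apply (A := fun _ : S => Bool) i).isOpen_preimage {b} (isOpen_discrete {b})

/-- An open set containing all supersets of `X` contains all supersets of a finite subset
of `X`. -/
theorem exists_finset_of_isOpen {S : Type*} {X : Set S} {O : Set (S → Bool)} (hO : IsOpen O)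
    (hX : {y : S → Bool | ∀ i ∈ X, y i = true} ⊆ O) :
    ∃ a : Finset S, (a : Set S) ⊆ X ∧ {y : S → Bool | ∀ i ∈ a, y i = true} ⊆ O := by
  classical
  have hcov : Oᶜ ⊆ ⋃ i ∈ X, {y : S → Bool | y i = false} := by
    intro y hy
    by_contra h
    simp only [Set.mem_iUnion, Set.mem_ofPred_eq, not_exists, Bool.not_eq_false] at h
    exact hy (hX h)
  obtain ⟨b, hbX, hb, hcb⟩ := hO.isClosed_compl.isCompact.elim_finite_subcover_image
    (fun i _ => isOpen_eval_eq i false) hcov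
  refine ⟨hb.toFinset, by simpa using hbX, fun y hy => ?_⟩
  by_contra hyO
  obtain ⟨i, hi, hyi⟩ := Set.mem_iUnion₂.1 (hcb hyO)
  have := hy i (by simpa using hi)
  simp_all

theorem FinMenger.isMenger {S : Type*} {F : Filter S} (h : FinMenger F) : IsMenger F := by
  intro U hU
  -- The finite sets whose basic neighbourhood is covered by finitely many members of `U n`.
  let 𝒜 : ℕ → Set (Finset S) := fun n =>
    {a | ∃ V ⊆ U n, V.Finite ∧ ∀ x : cantorSubspace F.sets, (∀ i ∈ a, x.1 i = true) → x ∈ ⋃₀ V}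
  obtain ⟨ℬ, hℬ, hit⟩ := h 𝒜 (fun n X hX => by
    have hKF : {y : S → Bool | ∀ i ∈ X, y i = true} ⊆ cantorSubspace F.sets :=
      fun y hy => Filter.mem_of_superset hX hy
    have hK : IsCompact {x : cantorSubspace F.sets | ∀ i ∈ X, x.1 i = true} := by
      rw [Subtype.isCompact_iff]
      convert (isClosed_forall_eq_true X).isCompact using 1
      ext y
      constructor
      · rintro ⟨x, hx, rfl⟩
        exact hx
      · intro hy
        exact ⟨⟨y, hKF hy⟩, hy, rfl⟩
    obtain ⟨V, hVU, hVfin, hV⟩ := hK.elim_finite_subcover_image (b := U n) (c := id)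
      (hU n).1 (by simp only [id, ← Set.sUnion_eq_biUnion, (hU n).2, Set.subset_univ])
    have hVo : IsOpen (⋃₀ V) := isOpen_sUnion fun u hu => (hU n).1 u (hVU hu)
    obtain ⟨O, hO, hOV⟩ := isOpen_induced_iff.1 hVo
    obtain ⟨a, haX, ha⟩ := exists_finset_of_isOpen hO (X := X) (fun y hy => by
      have : (⟨y, hKF hy⟩ : cantorSubspace F.sets) ∈ ⋃₀ V := by
        rw [Set.sUnion_eq_biUnion]; exact hV hy
      rw [← hOV] at this
      exact this)
    refine ⟨a, ⟨V, hVU, hVfin, fun x hx => ?_⟩, haX⟩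
    rw [← hOV]
    exact ha hx)
  have hch : ∀ n a, ∃ V : Set (Set (cantorSubspace F.sets)), V ⊆ U n ∧ V.Finite ∧
      (a ∈ 𝒜 n → ∀ x : cantorSubspace F.sets, (∀ i ∈ a, x.1 i = true) → x ∈ ⋃₀ V) := by
    intro n a
    by_cases ha : a ∈ 𝒜 n
    · obtain ⟨V, h1, h2, h3⟩ := ha
      exact ⟨V, h1, h2, fun _ => h3⟩
    · exact ⟨∅, by simp, by simp, fun h => absurd h ha⟩
  choose V hVU hVfin hV using hch
  refine ⟨fun n => ⋃ a ∈ ℬ n, V n a, fun n => ⟨Set.iUnion₂_subset fun a _ => hVU n a,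
    (hℬ n).2.biUnion fun a _ => hVfin n a⟩, Set.eq_univ_of_forall fun x => ?_⟩
  obtain ⟨a, ha, hax⟩ := hit _ x.2
  obtain ⟨n, ha⟩ := Set.mem_iUnion.1 ha
  obtain ⟨u, hu, hxu⟩ := hV n a ((hℬ n).1 ha) x hax
  exact Set.mem_iUnion.2 ⟨n, u, Set.mem_iUnion₂.2 ⟨a, ha, hu⟩, hxu⟩

theorem IsMenger.finMenger {S : Type*} {F : Filter S} (h : IsMenger F) : FinMenger F := by
  classical
  intro 𝒜 h𝒜
  let N : Finset S → Set (cantorSubspace F.sets) := fun a => {x | ∀ i ∈ a, x.1 i = true}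
  obtain ⟨V, hV, hcov⟩ := h (fun n => N '' 𝒜 n) (fun n => by
    constructor
    · rintro _ ⟨a, -, rfl⟩
      have : N a = ⋂ i ∈ a, Subtype.val ⁻¹' {y : S → Bool | y i = true} := by
        ext x; simp [N]
      rw [this]
      exact isOpen_biInter_finset fun i _ => (isOpen_eval_eq i true).preimage continuous_subtype_val
    · refine Set.eq_univ_of_forall fun x => ?_
      obtain ⟨a, ha, hax⟩ := h𝒜 n _ x.2
      exact ⟨N a, ⟨a, ha, rfl⟩, hax⟩)
  have hch : ∀ n, ∃ ℬ ⊆ 𝒜 n, ℬ.Finite ∧ N '' ℬ = V n := fun n => by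
    obtain ⟨t, ht, hbij⟩ := Set.SurjOn.exists_bijOn_subset (hV n).1
    exact ⟨t, ht, hbij.finite_iff_finite.2 (hV n).2, hbij.image_eq⟩
  choose ℬ hℬ𝒜 hℬfin hℬV using hch
  refine ⟨ℬ, fun n => ⟨hℬ𝒜 n, hℬfin n⟩, fun X hX => ?_⟩
  have hx : (fun i => decide (i ∈ X)) ∈ cantorSubspace F.sets := by
    simpa [cantorSubspace, toSet] using hX
  obtain ⟨n, u, hu, hxu⟩ := Set.mem_iUnion.1 (hcov.symm ▸ Set.mem_univ
    (⟨_, hx⟩ : cantorSubspace F.sets))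
  rw [← hℬV n] at hu
  obtain ⟨a, ha, rfl⟩ := hu
  exact ⟨a, Set.mem_iUnion.2 ⟨n, ha⟩, fun i hi => by simpa using hxu i hi⟩

theorem isMenger_iff_finMenger {S : Type*} {F : Filter S} : IsMenger F ↔ FinMenger F :=
  ⟨IsMenger.finMenger, FinMenger.isMenger⟩

/-- The combinatorial Menger property is inherited along maps of finite sets that preserve and
reflect `Hits`. -/
theorem FinMenger.of_hits_image {S T : Type*} {F : Filter S} {G : Filter T}
    (φ : Finset S → Finset T) (hφ : ∀ 𝒜, Hits F 𝒜 ↔ Hits G (φ '' 𝒜)) (h : FinMenger G) :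
    FinMenger F := by
  intro 𝒜 h𝒜
  obtain ⟨ℬ, hℬ, hit⟩ := h (fun n => φ '' 𝒜 n) fun n => (hφ _).1 (h𝒜 n)
  have hch : ∀ n, ∃ 𝒞 ⊆ 𝒜 n, 𝒞.Finite ∧ φ '' 𝒞 = ℬ n := fun n => by
    obtain ⟨t, ht, hbij⟩ := Set.SurjOn.exists_bijOn_subset (hℬ n).1
    exact ⟨t, ht, hbij.finite_iff_finite.2 (hℬ n).2, hbij.image_eq⟩
  choose 𝒞 h𝒞𝒜 h𝒞fin h𝒞 using hch
  refine ⟨𝒞, fun n => ⟨h𝒞𝒜 n, h𝒞fin n⟩, (hφ _).2 ?_⟩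
  rw [Set.image_iUnion]
  simpa only [h𝒞] using hit

theorem FinMenger.of_map_equiv {S T : Type*} {F : Filter S} (e : S ≃ T)
    (h : FinMenger (F.map e)) : FinMenger F := by
  refine h.of_hits_image (fun a => a.map e.toEmbedding) fun 𝒜 => ⟨fun h𝒜 X hX => ?_,
    fun h𝒜 X hX => ?_⟩
  · obtain ⟨a, ha, haX⟩ := h𝒜 _ hX
    exact ⟨_, ⟨a, ha, rfl⟩, by simpa using haX⟩
  · obtain ⟨_, ⟨a, ha, rfl⟩, haX⟩ := h𝒜 (e '' X) (Filter.image_mem_map hX)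
    refine ⟨a, ha, ?_⟩
    simpa using haX

theorem finMenger_map_equiv {S T : Type*} {F : Filter S} (e : S ≃ T) :
    FinMenger (F.map e) ↔ FinMenger F := by
  refine ⟨FinMenger.of_map_equiv e, fun h => FinMenger.of_map_equiv e.symm ?_⟩
  simpa [Filter.map_map] using h

/-! ### The filter `F^{<ω}` -/

theorem finPow_le_cofinite {F : Filter ℕ} (hcof : F ≤ Filter.cofinite) :
    finPow F ≤ Filter.cofinite := by
  rw [Filter.le_cofinite_iff_compl_singleton_mem] at hcof ⊢
  intro a
  obtain ⟨i, hi⟩ := a.2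
  refine ⟨{i}ᶜ, hcof i, fun b hb hba => ?_⟩
  rw [Set.mem_singleton_iff] at hba
  subst hba
  exact hb hi rfl

theorem finMenger_finPow {F : Filter ℕ} : FinMenger (finPow F) ↔ FinMenger F := by
  classical
  constructor
  · refine FinMenger.of_hits_image
      -- The value `∅` is harmless: both it and the empty `a` lie below every set.
      (fun a => if h : a.Nonempty then {⟨a, h⟩} else ∅) fun 𝒜 => ⟨?_, ?_⟩
    · rintro h𝒜 X ⟨A, hA, hAX⟩
      obtain ⟨a, ha, haA⟩ := h𝒜 A hA
      refine ⟨_, ⟨a, ha, rfl⟩, ?_⟩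
      by_cases hne : a.Nonempty
      · simpa [hne] using hAX haA
      · simp [hne]
    · intro h𝒜 A hA
      obtain ⟨_, ⟨a, ha, rfl⟩, haA⟩ := h𝒜 {b | (b.1 : Set ℕ) ⊆ A} ⟨A, hA, subset_rfl⟩
      refine ⟨a, ha, ?_⟩
      by_cases hne : a.Nonempty
      · simpa [hne] using haA
      · simp [Finset.not_nonempty_iff_eq_empty.1 hne]
  · refine FinMenger.of_hits_image (fun a => a.biUnion Subtype.val) fun 𝒜 => ⟨?_, ?_⟩
    · intro h𝒜 A hA
      obtain ⟨a, ha, haA⟩ := h𝒜 {b | (b.1 : Set ℕ) ⊆ A} ⟨A, hA, subset_rfl⟩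
      refine ⟨_, ⟨a, ha, rfl⟩, ?_⟩
      rw [Finset.coe_biUnion]
      exact Set.iUnion₂_subset fun b hb => haA hb
    · rintro h𝒜 X ⟨A, hA, hAX⟩
      obtain ⟨_, ⟨a, ha, rfl⟩, haA⟩ := h𝒜 A hA
      rw [Finset.coe_biUnion] at haA
      exact ⟨a, ha, fun b hb =>
        hAX ((Set.subset_iUnion₂ (s := fun b _ => (b.1 : Set ℕ)) b hb).trans haA)⟩

theorem mem_positive_finPow {F : Filter ℕ} {X : Set NeFin} :
    X ∈ positive (finPow F) ↔ Hits F (Subtype.val '' X) := by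
  constructor
  · intro hX A hA
    by_contra h
    push Not at h
    exact hX ⟨A, hA, fun a ha haX => h a.1 ⟨a, haX, rfl⟩ ha⟩
  · rintro hX ⟨A, hA, h⟩
    obtain ⟨_, ⟨a, haX, rfl⟩, haA⟩ := hX A hA
    exact h haA haX

/-- The union of the finite selections is a pseudo-intersection: as `X` decreases, what lies outside
`X n` was selected at a stage before `n`. -/
theorem FinMenger.isPPlus_finPow {F : Filter ℕ} (h : FinMenger F) : IsPPlus (finPow F) := by
  intro X hX hpos
  obtain ⟨ℬ, hℬ, hit⟩ := h _ fun n => mem_positive_finPow.1 (hpos n)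
  refine ⟨Subtype.val ⁻¹' ⋃ n, ℬ n, mem_positive_finPow.2 ?_, fun n => ?_⟩
  · rwa [Set.image_preimage_eq_of_subset]
    refine Set.iUnion_subset fun n => (hℬ n).1.trans (Set.image_subset_range _ _)
  · refine ((Set.finite_lt_nat n).biUnion fun m _ => (hℬ m).2).preimage
      Subtype.val_injective.injOn |>.subset ?_
    rintro a ⟨ha, han⟩
    obtain ⟨m, hm⟩ := Set.mem_iUnion.1 ha
    refine Set.mem_iUnion₂.2 ⟨m, ?_, hm⟩
    by_contra hmn
    obtain ⟨b, hb, hba⟩ := (hℬ m).1 hm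
    exact han (hX (not_lt.1 hmn) (Subtype.val_injective hba ▸ hb))

theorem compl_mem_of_finite {S : Type*} {F : Filter S} (hcof : F ≤ Filter.cofinite) {s : Set S}
    (hs : s.Finite) : sᶜ ∈ F :=
  hcof hs.compl_mem_cofinite

/-- Let `Y` be a positive pseudo-intersection of the sets `X n`. An `a ∈ Y` that leaves the sequence
after `X n` lies in the finite set `Y \ X (n + 1)` and contains a member of `𝒜 n`. -/
theorem IsPPlus.finMenger {F : Filter ℕ} (hne : F.NeBot) (hcof : F ≤ Filter.cofinite)
    (h : IsPPlus (finPow F)) : FinMenger F := by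
  classical
  intro 𝒜 h𝒜
  let X : ℕ → Set NeFin := fun n => {a | ∀ i ≤ n, ∃ b ∈ 𝒜 i, b ⊆ a.1}
  have hX : Antitone X := fun m n hmn a ha i hi => ha i (hi.trans hmn)
  obtain ⟨Y, hY, hfin⟩ := h X hX (fun n => mem_positive_finPow.2 fun A hA => by
    choose b hb hbA using fun i => h𝒜 i A hA
    obtain ⟨j, hj⟩ := hne.nonempty_of_mem hA
    refine ⟨_, ⟨⟨insert j ((Finset.range (n + 1)).biUnion b), Finset.insert_nonempty _ _⟩,
      fun i hi => ⟨b i, hb i, ?_⟩, rfl⟩, ?_⟩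
    · exact (Finset.subset_biUnion_of_mem b (Finset.mem_range.2 (Nat.lt_succ_of_le hi))).trans
        (Finset.subset_insert _ _)
    · simp only [Finset.coe_insert, Finset.coe_biUnion]
      exact Set.insert_subset hj (Set.iUnion₂_subset fun i _ => hbA i))
  rw [mem_positive_finPow] at hY
  -- An `a` that never leaves the sequence is handled at stage `encode a`.
  let Z : ℕ → Set NeFin := fun n => Y \ X (n + 1) ∪ {a | Encodable.encode a ≤ n}
  have hZ : ∀ n, (Z n).Finite := fun n => (hfin _).union
    ((Set.finite_le_nat n).preimage Encodable.encode_injective.injOn)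
  refine ⟨fun n => {b ∈ 𝒜 n | ∃ a ∈ Z n, b ⊆ a.1}, fun n => ⟨fun b hb => hb.1, ?_⟩,
    fun A hA => ?_⟩
  · refine ((hZ n).biUnion fun a _ => (a.1.powerset).finite_toSet).subset ?_
    rintro b ⟨-, a, ha, hba⟩
    exact Set.mem_iUnion₂.2 ⟨a, ha, by simpa using hba⟩
  -- Removing these points from `A` excludes the finitely many `a ∈ Y` outside `X 0`, which no stage
  -- handles.
  · have hD : (⋃ a ∈ Y \ X 0, (a.1 : Set ℕ)).Finite :=
      (hfin 0).biUnion fun a _ => a.1.finite_toSet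
    obtain ⟨_, ⟨a, haY, rfl⟩, haA⟩ := hY _ (Filter.inter_mem hA (compl_mem_of_finite hcof hD))
    have ha0 : a ∈ X 0 := by
      by_contra ha
      obtain ⟨i, hi⟩ := a.2
      exact (haA hi).2 (Set.mem_iUnion₂.2 ⟨a, ⟨haY, ha⟩, hi⟩)
    obtain ⟨n, haX, haZ⟩ : ∃ n, a ∈ X n ∧ a ∈ Z n := by
      by_cases hall : ∀ n, a ∈ X n
      · exact ⟨Encodable.encode a, hall _, Or.inr (Set.mem_ofPred.2 le_rfl)⟩
      · push Not at hall
        have hpos : Nat.find hall ≠ 0 := fun h0 => Nat.find_spec hall (h0 ▸ ha0)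
        obtain ⟨n, hn⟩ := Nat.exists_eq_succ_of_ne_zero hpos
        refine ⟨n, not_not.1 (Nat.find_min hall (m := n) (by omega)), Or.inl ⟨haY, ?_⟩⟩
        have := Nat.find_spec hall
        rwa [hn] at this
    obtain ⟨b, hb, hba⟩ := haX n le_rfl
    exact ⟨b, Set.mem_iUnion.2 ⟨n, hb, a, haZ, hba⟩,
      (Finset.coe_subset.2 hba).trans (haA.trans Set.inter_subset_left)⟩

/-! ### Strong `P⁺`-filters -/

theorem mem_positive_iff {S : Type*} {F : Filter S} {X : Set S} :
    X ∈ positive F ↔ ∀ A ∈ F, (X ∩ A).Nonempty := by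
  constructor
  · intro hX A hA
    by_contra h
    rw [Set.not_nonempty_iff_eq_empty, ← Set.disjoint_iff_inter_eq_empty] at h
    exact hX (Filter.mem_of_superset hA h.subset_compl_left)
  · intro h hX
    obtain ⟨i, hi, hi'⟩ := h _ hX
    exact hi' hi

/-- If `A` contains no member of `𝒜 n` below `k (n + 1)`, then `Aᶜ ∪ [k (n + 1), ∞)` meets every
member of `𝒜 n`. Were this so for all `n`, gluing these sets along the intervals would give a
positive set disjoint from `A`. -/
theorem IsStrongPPlus.finMenger {F : Filter ℕ} (h : IsStrongPPlus F) : FinMenger F := by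
  classical
  intro 𝒜 h𝒜
  let C : ℕ → Set (ℕ → Bool) := fun n => {x | ∀ a ∈ 𝒜 n, ∃ i ∈ a, x i = true}
  have hC : ∀ n, IsClosed (C n) := fun n => by
    have : C n = ⋂ a ∈ 𝒜 n, ⋃ i ∈ a, {x | x i = true} := by ext x; simp [C]
    rw [this]
    exact isClosed_biInter fun a _ => a.finite_toSet.isClosed_biUnion fun i _ =>
      isClosed_eq (continuous_apply i) continuous_const
  obtain ⟨k, -, hk⟩ := h C fun n => ⟨(hC n).isCompact, fun x hx => mem_positive_iff.2 fun A hA => by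
    obtain ⟨a, ha, haA⟩ := h𝒜 n A hA
    obtain ⟨i, hi, hxi⟩ := hx a ha
    exact ⟨i, hxi, haA hi⟩⟩
  refine ⟨fun n => {a ∈ 𝒜 n | a ⊆ Finset.range (k (n + 1))}, fun n => ⟨fun a ha => ha.1, ?_⟩,
    fun A hA => ?_⟩
  · exact (Finset.range (k (n + 1))).powerset.finite_toSet.subset
      fun a ha => Finset.mem_coe.2 (Finset.mem_powerset.2 ha.2)
  · by_contra hcon
    push Not at hcon
    have hpos := hk (fun n i => decide (i ∉ A ∨ k (n + 1) ≤ i)) (fun n a ha => by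
      by_contra hno
      push Not at hno
      have hno' : ∀ i ∈ a, i ∈ A ∧ i < k (n + 1) := by simpa using hno
      exact hcon a (Set.mem_iUnion.2 ⟨n, ha, fun i hi => Finset.mem_range.2 (hno' i hi).2⟩)
        fun i hi => (hno' i hi).1)
    obtain ⟨i, hi, hiA⟩ := mem_positive_iff.1 hpos A hA
    obtain ⟨n, hin, -, hlt⟩ := Set.mem_iUnion.1 hi
    simp only [toSet, Set.mem_ofPred_eq, decide_eq_true_eq] at hin
    rcases hin with hin | hin
    · exact hin hiA
    · omega

theorem exists_strictMono_iterate (g : ℕ → ℕ) :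
    ∃ k : ℕ → ℕ, k 0 = 0 ∧ StrictMono k ∧ ∀ i, ∀ n ≤ k i, g n ≤ k (i + 1) := by
  let k : ℕ → ℕ := fun i =>
    Nat.rec 0 (fun _ m => m + 1 + (Finset.range (m + 1)).sup g) i
  have hk : ∀ i, k (i + 1) = k i + 1 + (Finset.range (k i + 1)).sup g := fun _ => rfl
  refine ⟨k, rfl, strictMono_nat_of_lt_succ fun i => by rw [hk]; omega, fun i n hn => ?_⟩
  have := Finset.le_sup (f := g) (Finset.mem_range.2 (Nat.lt_add_one_of_le hn))
  rw [hk]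
  omega

/-- The combinatorial Menger property with the finite families replaced by consecutive
intervals. -/
theorem FinMenger.exists_intervals {F : Filter ℕ} (hcof : F ≤ Filter.cofinite) (h : FinMenger F)
    {𝒜 : ℕ → Set (Finset ℕ)} (h𝒜 : ∀ n, Hits F (𝒜 n)) :
    ∃ k : ℕ → ℕ, StrictMono k ∧
      ∀ A ∈ F, ∃ n, ∃ a ∈ 𝒜 n, (a : Set ℕ) ⊆ A ∩ Set.Ico (k n) (k (n + 1)) := by
  classical
  obtain ⟨ℬ, hℬ, hit⟩ := h
    -- Asking for members of all earlier families beyond all earlier bounds lets the index of a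
    -- selected `b` be rounded down to an interval endpoint.
    (fun n => {b | ∀ i ≤ n, ∀ m ≤ n, ∃ a ∈ 𝒜 i, a ⊆ b ∧ ∀ j ∈ a, m ≤ j}) fun n A hA => by
      have : ∀ i, ∃ a ∈ 𝒜 i, (a : Set ℕ) ⊆ A ∩ {j | j < n}ᶜ := fun i =>
        h𝒜 i _ (Filter.inter_mem hA (compl_mem_of_finite hcof (Set.finite_lt_nat n)))
      choose a ha haA using this
      refine ⟨(Finset.range (n + 1)).biUnion a, fun i hi m hm => ⟨a i, ha i,
        Finset.subset_biUnion_of_mem a (Finset.mem_range.2 (Nat.lt_succ_of_le hi)),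
        fun j hj => hm.trans (not_lt.1 (haA i hj).2)⟩, ?_⟩
      rw [Finset.coe_biUnion]
      exact Set.iUnion₂_subset fun i _ => (haA i).trans Set.inter_subset_left
  have hg : ∀ n, ∃ N, ∀ b ∈ ℬ n, ∀ j ∈ b, j < N := fun n => by
    obtain ⟨N, hN⟩ := ((hℬ n).2.biUnion fun b _ => b.finite_toSet).bddAbove
    exact ⟨N + 1, fun b hb j hj => Nat.lt_succ_of_le (hN (Set.mem_iUnion₂.2 ⟨b, hb, hj⟩))⟩
  choose g hg using hg
  obtain ⟨k, hk0, hk, hkg⟩ := exists_strictMono_iterate g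
  -- every `A ∈ F` is good for some pair of consecutive intervals
  have key : ∀ A ∈ F, ∃ i, ∀ j ≤ i, ∃ a ∈ 𝒜 j, (a : Set ℕ) ⊆ A ∩ Set.Ico (k i) (k (i + 2)) := by
    intro A hA
    obtain ⟨b, hb, hbA⟩ := hit A hA
    obtain ⟨n, hb⟩ := Set.mem_iUnion.1 hb
    obtain ⟨i, hi, hi'⟩ : ∃ i, k i ≤ n ∧ n < k (i + 1) := by
      have hex : ∃ i, n < k i := ⟨n + 1, hk.le_apply (x := n + 1)⟩
      have hpos : Nat.find hex ≠ 0 := fun h0 => by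
        have := Nat.find_spec hex
        rw [h0, hk0] at this
        omega
      obtain ⟨i, hi⟩ := Nat.exists_eq_succ_of_ne_zero hpos
      refine ⟨i, not_lt.1 (Nat.find_min hex (m := i) (by omega)), ?_⟩
      have := Nat.find_spec hex
      rwa [hi] at this
    refine ⟨i, fun j hj => ?_⟩
    obtain ⟨a, ha, hab, hak⟩ := (hℬ n).1 hb j (hj.trans (hk.le_apply.trans hi)) (k i) hi
    exact ⟨a, ha, fun l hl => ⟨hbA (hab hl), hak l hl,
      (hg n b hb l (hab hl)).trans_le (hkg (i + 1) n hi'.le)⟩⟩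
  -- The intervals `[k i, k (i + 2))` overlap. If those with `i` even fail for some `B`, those with
  -- `i` odd succeed for every `A`, by applying `key` to `A ∩ B`.
  by_cases heven : ∀ A ∈ F, ∃ n, ∃ a ∈ 𝒜 n,
      (a : Set ℕ) ⊆ A ∩ Set.Ico (k (2 * n)) (k (2 * (n + 1)))
  · exact ⟨fun n => k (2 * n), fun m n hmn => hk (by omega), heven⟩
  push Not at heven
  obtain ⟨B, hB, hBno⟩ := heven
  refine ⟨fun n => k (2 * n + 1), fun m n hmn => hk (by omega), fun A hA => ?_⟩
  obtain ⟨i, hi⟩ := key _ (Filter.inter_mem hA hB)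
  obtain ⟨j, rfl | rfl⟩ := Nat.even_or_odd' i
  · obtain ⟨a, ha, haA⟩ := hi j (by omega)
    exact absurd (haA.trans (Set.inter_subset_inter_left _ Set.inter_subset_right)) (hBno j a ha)
  · obtain ⟨a, ha, haA⟩ := hi j (by omega)
    exact ⟨j, a, ha, haA.trans (Set.inter_subset_inter_left _ Set.inter_subset_left)⟩

/-- By compactness of `C n`, each `A ∈ F` has a finite subset meeting every member of `C n`. -/
theorem FinMenger.isStrongPPlus {F : Filter ℕ} (hcof : F ≤ Filter.cofinite) (h : FinMenger F) :
    IsStrongPPlus F := by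
  intro C hC
  obtain ⟨k, hk, hkF⟩ := h.exists_intervals hcof
    (𝒜 := fun n => {a | ∀ x ∈ C n, ∃ i ∈ a, x i = true}) fun n A hA => by
      obtain ⟨b, hbA, hb, hcov⟩ := (hC n).1.elim_finite_subcover_image
        (b := A) (c := fun i => {x : ℕ → Bool | x i = true})
        (fun i _ => isOpen_eval_eq i true) fun x hx => by
          obtain ⟨i, hi, hiA⟩ := mem_positive_iff.1 ((hC n).2 hx) A hA
          exact Set.mem_iUnion₂.2 ⟨i, hiA, hi⟩
      refine ⟨hb.toFinset, fun x hx => ?_, by simpa using hbA⟩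
      obtain ⟨i, hi, hxi⟩ := Set.mem_iUnion₂.1 (hcov hx)
      exact ⟨i, by simpa using hi, hxi⟩
  refine ⟨k, hk, fun X hX => mem_positive_iff.2 fun A hA => ?_⟩
  obtain ⟨n, a, ha, haA⟩ := hkF A hA
  obtain ⟨i, hi, hxi⟩ := ha (X n) (hX n)
  exact ⟨i, Set.mem_iUnion.2 ⟨n, hxi, (haA hi).2⟩, (haA hi).1⟩

theorem isStrongPPlus_iff_finMenger {F : Filter ℕ} (hcof : F ≤ Filter.cofinite) :
    IsStrongPPlus F ↔ FinMenger F :=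
  ⟨IsStrongPPlus.finMenger, FinMenger.isStrongPPlus hcof⟩

/-! ### Dominating reals in Mathias extensions -/

section RealName

variable {P : Type*} [Preorder P]

theorem RealName.ForcesEq.mono {x : RealName P} {n k : ℕ} {p q : P} (h : x.ForcesEq n k p)
    (hqp : q ≤ p) : x.ForcesEq n k q :=
  fun r hr => h r (hr.trans hqp)

theorem RealName.forcesEq_of_le {x : RealName P} {n k : ℕ} {p c : P} (hc : c ∈ x.val n k)
    (hpc : p ≤ c) : x.ForcesEq n k p :=
  fun q hq => ⟨q, le_rfl, c, hc, hq.trans hpc⟩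

theorem RealName.ForcesEq.unique {x : RealName P} {n k l : ℕ} {p : P} (hk : x.ForcesEq n k p)
    (hl : x.ForcesEq n l p) : k = l := by
  obtain ⟨q, hq, c, hc, hqc⟩ := hk p le_rfl
  obtain ⟨r, hr, d, hd, hrd⟩ := hl q hq
  exact x.functional n k l c d hc hd ⟨r, hr.trans hqc, hrd⟩

theorem RealName.exists_forcesEq (x : RealName P) (n : ℕ) (p : P) :
    ∃ k, ∃ q ≤ p, x.ForcesEq n k q := by
  obtain ⟨k, c, hc, r, hrp, hrc⟩ := x.total n p
  exact ⟨k, r, hrp, forcesEq_of_le hc hrc⟩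

end RealName

namespace Mathias

variable {F : Filter ℕ}

theorem le_iff {p q : Mathias F} : p ≤ q ↔ p.side ⊆ q.side ∧
    (q.stem ⊆ p.stem ∧ ∀ i ∈ q.stem, ∀ j ∈ p.stem \ q.stem, i < j) ∧
    ((p.stem \ q.stem : Finset ℕ) : Set ℕ) ⊆ q.side := Iff.rfl

theorem mem_side_of_le {p q : Mathias F} (h : p ≤ q) {i : ℕ} (hi : i ∈ p.stem)
    (hiq : i ∉ q.stem) : i ∈ q.side :=
  h.2.2 (by simp [hi, hiq])

theorem finite_not_lt (s : Finset ℕ) : {j : ℕ | ¬ ∀ i ∈ s, i < j}.Finite := by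
  refine (Set.finite_le_nat (s.sup id)).subset fun j hj => ?_
  simp only [Set.mem_ofPred_eq, not_forall] at hj
  obtain ⟨i, hi, hij⟩ := hj
  exact (not_lt.1 hij).trans (Finset.le_sup (f := id) hi)

theorem sep_lt_mem (hcof : F ≤ Filter.cofinite) (s : Finset ℕ) {A : Set ℕ} (hA : A ∈ F) :
    {j ∈ A | ∀ i ∈ s, i < j} ∈ F := by
  refine Filter.mem_of_superset
    (Filter.inter_mem hA (compl_mem_of_finite hcof (finite_not_lt s))) fun j hj => ⟨hj.1, ?_⟩
  exact not_not.1 hj.2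

/-- The condition with stem `s` and side the part of `A` above `s`. -/
def ofStem (hcof : F ≤ Filter.cofinite) (s : Finset ℕ) {A : Set ℕ} (hA : A ∈ F) : Mathias F where
  stem := s
  side := {j ∈ A | ∀ i ∈ s, i < j}
  side_mem := sep_lt_mem hcof s hA
  stem_lt_side := fun i hi _ hj => hj.2 i hi

/-! ### A dominating real from a failure of the Menger property -/

/-- The part of the generic real in `[n, k)` determined by the stem `s` contains a member
of `𝒜`. -/
def Captures (𝒜 : Set (Finset ℕ)) (s : Finset ℕ) (n k : ℕ) : Prop :=
  ∃ a ∈ 𝒜, ∀ i ∈ a, i ∈ s ∧ n ≤ i ∧ i < k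

theorem Captures.of_le {𝒜 : Set (Finset ℕ)} {p r : Mathias F} {n k l : ℕ} (hrp : r ≤ p)
    (hk : ∀ j ∈ p.side, k ≤ j) (hlk : l ≤ k) (h : Captures 𝒜 r.stem n l) :
    Captures 𝒜 p.stem n l := by
  obtain ⟨a, ha, h⟩ := h
  refine ⟨a, ha, fun i hi => ⟨?_, (h i hi).2⟩⟩
  by_contra hip
  have := hk i (mem_side_of_le hrp (h i hi).1 hip)
  have := (h i hi).2.2
  omega

theorem Captures.mono {𝒜 : Set (Finset ℕ)} {s t : Finset ℕ} {n k : ℕ} (hst : s ⊆ t)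
    (h : Captures 𝒜 s n k) : Captures 𝒜 t n k := by
  obtain ⟨a, ha, h⟩ := h
  exact ⟨a, ha, fun i hi => ⟨hst (h i hi).1, (h i hi).2⟩⟩

/-- The conditions deciding that `k` is least such that the part of the generic real in `[n, k)`
contains a member of `𝒜 n`. -/
def captureVal (F : Filter ℕ) (𝒜 : ℕ → Set (Finset ℕ)) (n k : ℕ) : Set (Mathias F) :=
  {p | (∀ j ∈ p.side, k ≤ j) ∧ Captures (𝒜 n) p.stem n k ∧
    ∀ l < k, ¬ Captures (𝒜 n) p.stem n l}

theorem exists_le_mem_captureVal (hcof : F ≤ Filter.cofinite) {𝒜 : ℕ → Set (Finset ℕ)}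
    (h𝒜 : ∀ n, Hits F (𝒜 n)) (n : ℕ) (p : Mathias F) :
    ∃ k, ∃ q ≤ p, q ∈ captureVal F 𝒜 n k := by
  classical
  obtain ⟨a, ha, hap⟩ := h𝒜 n _ (Filter.inter_mem p.side_mem
    (compl_mem_of_finite hcof (Set.finite_lt_nat n)))
  have hex : ∃ k, Captures (𝒜 n) (p.stem ∪ a) n k :=
    ⟨a.sup id + 1, a, ha, fun i hi => ⟨Finset.mem_union_right _ hi, not_lt.1 (hap hi).2,
      Nat.lt_succ_of_le (Finset.le_sup (f := id) hi)⟩⟩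
  let k := Nat.find hex
  let q : Mathias F := ofStem hcof (p.stem ∪ a) (Filter.inter_mem p.side_mem
    (compl_mem_of_finite hcof (Set.finite_lt_nat k)))
  refine ⟨k, q, ⟨fun j hj => hj.1.1, ⟨Finset.subset_union_left, fun i hi j hj => ?_⟩,
    fun j hj => ?_⟩, fun j hj => not_lt.1 hj.1.2, Nat.find_spec hex,
    fun l hl => Nat.find_min hex hl⟩
  · have hj' : j ∈ a := by
      simp only [q, ofStem, Finset.mem_sdiff, Finset.mem_union] at hj
      tauto
    exact p.stem_lt_side i hi j (hap hj').1
  · have hj' : j ∈ a := by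
      simp only [q, ofStem, Finset.coe_sdiff, Set.mem_sdiff, Finset.mem_coe, Finset.mem_union] at hj
      tauto
    exact (hap hj').1

/-- The name for the function sending `n` to the least `k` such that the part of the generic
real in `[n, k)` contains a member of `𝒜 n`. -/
def captureName (hcof : F ≤ Filter.cofinite) {𝒜 : ℕ → Set (Finset ℕ)}
    (h𝒜 : ∀ n, Hits F (𝒜 n)) : RealName (Mathias F) where
  val := captureVal F 𝒜
  functional := by
    have aux : ∀ (n k l : ℕ) (p q : Mathias F), p ∈ captureVal F 𝒜 n k →
        q ∈ captureVal F 𝒜 n l → Compatible p q → k ≤ l := by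
      rintro n k l p q hp hq ⟨r, hrp, hrq⟩
      by_contra hlt
      exact hp.2.2 l (not_le.1 hlt)
        ((hq.2.1.mono hrq.2.1.1).of_le hrp hp.1 (not_le.1 hlt).le)
    intro n k l p q hp hq hpq
    exact (aux n k l p q hp hq hpq).antisymm
      (aux n l k q p hq hp (by obtain ⟨r, h1, h2⟩ := hpq; exact ⟨r, h2, h1⟩))
  total := fun n p => by
    obtain ⟨k, q, hqp, hq⟩ := exists_le_mem_captureVal hcof h𝒜 n p
    exact ⟨k, q, hq, q, hqp, le_rfl⟩

theorem finMenger_of_addsNoDominatingReal (hcof : F ≤ Filter.cofinite)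
    (h : AddsNoDominatingReal (Mathias F)) : FinMenger F := by
  intro 𝒜 h𝒜
  by_contra hcon
  push Not at hcon
  refine h (captureName hcof h𝒜) (ofStem hcof ∅ Filter.univ_mem) fun f p _ => ?_
  have hno := hcon (fun n => {a ∈ 𝒜 n | a ⊆ Finset.range (f n)}) fun n => ⟨fun a ha => ha.1,
    (Finset.range (f n)).powerset.finite_toSet.subset fun a ha =>
      Finset.mem_coe.2 (Finset.mem_powerset.2 ha.2)⟩
  simp only [Hits, not_forall, not_exists, not_and] at hno
  obtain ⟨A, hA, hAno⟩ := hno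
  -- Beyond the stem the generic real now stays inside `A`, which contains no member of `𝒜 n` below
  -- `f n`. For `n` above the stem, a captured set avoids the stem, so its search bound exceeds `f
  -- n`.
  let q : Mathias F := ⟨p.stem, p.side ∩ A, Filter.inter_mem p.side_mem hA,
    fun i hi j hj => p.stem_lt_side i hi j hj.1⟩
  have hqp : q ≤ p := le_iff.2 ⟨Set.inter_subset_left, by simp [q], by simp [q]⟩
  refine ⟨q, hqp, p.stem.sup id + 1, Set.mem_univ _, fun n hn r hrq => ?_⟩
  obtain ⟨k, t, htr, ht⟩ := exists_le_mem_captureVal hcof h𝒜 n r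
  refine ⟨t, htr, k, ?_, RealName.forcesEq_of_le ht le_rfl⟩
  by_contra hkf
  obtain ⟨a, ha, hat⟩ := ht.2.1
  refine hAno a (Set.mem_iUnion.2 ⟨n, ha, fun i hi => Finset.mem_range.2
    ((hat i hi).2.2.trans (not_le.1 hkf))⟩) fun i hi => ?_
  refine (mem_side_of_le (htr.trans hrq) (hat i hi).1 fun hip => ?_).2
  have := Finset.le_sup (f := id) (show i ∈ p.stem from hip)
  have := (hat i hi).2.1
  simp only [id] at *
  omega

/-! ### Bounding names by the Menger property -/

/-- The finite set `t` can be added to the stem `s` so that some condition with the resulting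
stem forces `x(n) = k`. -/
def Decides (x : RealName (Mathias F)) (n : ℕ) (s t : Finset ℕ) (k : ℕ) : Prop :=
  ∃ q : Mathias F, q.stem = s ∪ t ∧ x.ForcesEq n k q

theorem exists_decides (hcof : F ≤ Filter.cofinite) (x : RealName (Mathias F)) (n : ℕ)
    (s : Finset ℕ) {A : Set ℕ} (hA : A ∈ F) :
    ∃ t : Finset ℕ, (t : Set ℕ) ⊆ A ∧ ∃ k, Decides x n s t k := by
  obtain ⟨k, q, hq, hk⟩ := x.exists_forcesEq n (ofStem hcof s hA)
  exact ⟨q.stem \ s, fun i hi => (hq.2.2 hi).1, k, q,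
    (Finset.union_sdiff_of_subset hq.2.1.1).symm, hk⟩

theorem addsNoDominatingReal_of_finMenger (hne : F.NeBot) (hcof : F ≤ Filter.cofinite)
    (h : FinMenger F) : AddsNoDominatingReal (Mathias F) := by
  classical
  intro x p hdom
  -- Nonemptiness ensures that deleting finitely many points from a side excludes all sets selected
  -- at the first stages.
  obtain ⟨ℬ, hℬ, hit⟩ := h (fun n => {a | a.Nonempty ∧ ∀ s ⊆ Finset.range n,
      ∃ t ⊆ a, ∃ k, Decides x n s t k}) fun n A hA => by
    choose t htA ht using fun s => exists_decides hcof x n s hA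
    obtain ⟨j, hj⟩ := hne.nonempty_of_mem hA
    refine ⟨insert j ((Finset.range n).powerset.biUnion t), ⟨Finset.insert_nonempty _ _,
      fun s hs => ⟨t s, ?_, ht s⟩⟩, ?_⟩
    · exact (Finset.subset_biUnion_of_mem t (Finset.mem_powerset.2 hs)).trans
        (Finset.subset_insert _ _)
    · simp only [Finset.coe_insert, Finset.coe_biUnion]
      exact Set.insert_subset hj (Set.iUnion₂_subset fun s _ => htA s)
  have hval : ∀ n s t, ∃ k, (∃ l, Decides x n s t l) → Decides x n s t k := fun n s t => by
    by_cases hl : ∃ l, Decides x n s t l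
    · exact ⟨hl.choose, fun _ => hl.choose_spec⟩
    · exact ⟨0, fun h => absurd h hl⟩
  choose v hv using hval
  -- `f n` exceeds every chosen value `v n s t` with `s ⊆ n` and `t` inside a selected set.
  let f : ℕ → ℕ := fun n => (Finset.range n).powerset.sup fun s =>
    (hℬ n).2.toFinset.sup fun b => b.powerset.sup fun t => v n s t + 1
  have hf : ∀ n, ∀ s ⊆ Finset.range n, ∀ b ∈ ℬ n, ∀ t ⊆ b, v n s t < f n := by
    intro n s hs b hb t ht
    have h1 := Finset.le_sup (f := fun t => v n s t + 1) (Finset.mem_powerset.2 ht)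
    have h2 := Finset.le_sup (f := fun b : Finset ℕ => b.powerset.sup fun t => v n s t + 1)
      ((hℬ n).2.mem_toFinset.2 hb)
    have h3 := Finset.le_sup (f := fun s => (hℬ n).2.toFinset.sup fun b =>
      b.powerset.sup fun t => v n s t + 1) (Finset.mem_powerset.2 hs)
    exact Nat.lt_of_succ_le (h1.trans (h2.trans h3))
  obtain ⟨r, -, m, -, hr⟩ := hdom f p le_rfl
  let N := max m (r.stem.sup id + 1)
  -- some `b ∈ ℬ n` with `n ≥ N` is contained in the side of `r`
  obtain ⟨n, hn, b, hb, hbr⟩ : ∃ n ≥ N, ∃ b ∈ ℬ n, (b : Set ℕ) ⊆ r.side := by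
    have hD : (⋃ n ∈ {n | n < N}, ⋃ b ∈ ℬ n, (b : Set ℕ)).Finite :=
      (Set.finite_lt_nat N).biUnion fun n _ => (hℬ n).2.biUnion fun b _ => b.finite_toSet
    obtain ⟨b, hb, hbr⟩ := hit _ (Filter.inter_mem r.side_mem (compl_mem_of_finite hcof hD))
    obtain ⟨n, hb⟩ := Set.mem_iUnion.1 hb
    refine ⟨n, ?_, b, hb, hbr.trans Set.inter_subset_left⟩
    by_contra hnN
    obtain ⟨i, hi⟩ := ((hℬ n).1 hb).1
    exact (hbr hi).2 (Set.mem_iUnion₂.2 ⟨n, not_le.1 hnN, Set.mem_iUnion₂.2 ⟨b, hb, hi⟩⟩)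
  have hrn : r.stem ⊆ Finset.range n := fun i hi => by
    have := Finset.le_sup (f := id) hi
    simp only [id, Finset.mem_range] at *
    omega
  obtain ⟨t, htb, hdec⟩ := ((hℬ n).1 hb).2 r.stem hrn
  obtain ⟨q, hqs, hq⟩ := hv n r.stem t hdec
  have htr : ∀ j ∈ t, j ∈ r.side := fun j hj => hbr (htb hj)
  -- Since `t` lies in the side of `r`, this is a common extension of `q` and `r`; it forces `x(n) <
  -- f n`, against the choice of `r`.
  let u : Mathias F := ⟨q.stem, q.side ∩ r.side, Filter.inter_mem q.side_mem r.side_mem,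
    fun i hi j hj => q.stem_lt_side i hi j hj.1⟩
  have huq : u ≤ q := le_iff.2 ⟨Set.inter_subset_left, by simp [u], by simp [u]⟩
  have hut : ∀ j ∈ u.stem \ r.stem, j ∈ t := fun j hj => by
    simp only [u, hqs, Finset.mem_sdiff, Finset.mem_union] at hj
    tauto
  have hur : u ≤ r := le_iff.2 ⟨Set.inter_subset_right,
    ⟨by simp only [u, hqs]; exact Finset.subset_union_left,
      fun i hi j hj => r.stem_lt_side i hi j (htr j (hut j hj))⟩,
    fun j hj => htr j (hut j (Finset.mem_coe.1 hj))⟩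
  obtain ⟨w, hwu, k, hk, hwk⟩ := hr n ((le_max_left _ _).trans hn) u hur
  have heq := hwk.unique (hq.mono (hwu.trans huq))
  have := hf n r.stem hrn b hb t htb
  simp only [Set.mem_ofPred_eq] at hk
  omega

end Mathias

theorem finPow_map_le_cofinite {F : Filter ℕ} (hcof : F ≤ Filter.cofinite) (e : NeFin ≃ ℕ) :
    (finPow F).map e ≤ Filter.cofinite :=
  (Filter.map_mono (finPow_le_cofinite hcof)).trans e.injective.tendsto_cofinite

end FilterForcing

theorem theorem3p5 (F : Filter ℕ) (hne : F.NeBot) (hcof : F ≤ Filter.cofinite)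
    (e : FilterForcing.NeFin ≃ ℕ) :
    List.TFAE
      [FilterForcing.AddsNoDominatingReal (FilterForcing.Mathias F),
       FilterForcing.IsMenger F,
       FilterForcing.IsMenger (FilterForcing.finPow F),
       FilterForcing.IsPPlus (FilterForcing.finPow F),
       FilterForcing.IsStrongPPlus F,
       FilterForcing.IsStrongPPlus ((FilterForcing.finPow F).map e)] := by
  open FilterForcing in
  rw [isMenger_iff_finMenger, isMenger_iff_finMenger, isStrongPPlus_iff_finMenger hcof,
    isStrongPPlus_iff_finMenger (finPow_map_le_cofinite hcof e), finMenger_map_equiv,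
    finMenger_finPow]
  tfae_have 1 ↔ 2 := ⟨FilterForcing.Mathias.finMenger_of_addsNoDominatingReal hcof,
    FilterForcing.Mathias.addsNoDominatingReal_of_finMenger hne hcof⟩
  tfae_have 2 ↔ 3 := Iff.rfl
  tfae_have 2 ↔ 4 := ⟨FilterForcing.FinMenger.isPPlus_finPow,
    FilterForcing.IsPPlus.finMenger hne hcof⟩
  tfae_have 2 ↔ 5 := Iff.rfl
  tfae_have 2 ↔ 6 := Iff.rfl
  tfae_finish
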